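/- Let $T\in(0,\infty)$ and $\alpha\in\mathbb{R}$ be fixed with $\alpha\neq 1$. An \emph{$\alpha$-Wiener bridge} is any almost surely continuous process $(X_t)_{t\in[0,T)}$ having the same finite-dimensional distributions as $$\int_0^t\Big(\frac{T-t}{T-s}\Big)^{\alpha}\,dB_s,\qquad t\in[0,T),$$ where $B$ is a standard Wiener process (this integral is the unique strong solution of $dX_t=-\frac{\alpha}{T-t}X_t\,dt+dB_t$, $X_0=0$). An \emph{Ornstein--Uhlenbeck type process} $(Z_t)_{t\ge 0}$ is a solution of $dZ_t=q(t)Z_t\,dt+\sigma(t)\,dB_t$, $t\ge 0$, where $q,\sigma:[0,\infty)\to\mathbb{R}$ are continuous, $\sigma(t)\neq 0$ for all $t\ge 0$, $B$ is a standard Wiener process and $Z_0$ is a Gauss random variable (possibly degenerate) independent of $B$. Put $\bar q(t)=\int_0^t q(u)\,du$ and $\gamma(s,t)=\int_s^t e^{2(\bar q(t)-\bar q(u))}\sigma^2(u)\,du$ for $0\le s\le t$. The \emph{bridge from $0$ to $0$ over $[0,T]$ derived from $Z$} is any almost surely continuous process on $[0,T]$ having the same finite-dimensional distributions as $$U_t=\int_0^t\frac{\gamma(t,T)}{\gamma(s,T)}\,e^{\bar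 q(t)-\bar q(s)}\sigma(s)\,dB_s,\quad t\in[0,T),\qquad U_T=0 .$$ There does not exist an Ornstein--Uhlenbeck type process $(Z_t)_{t\ge 0}$ such that the law of the bridge from $0$ to $0$ over $[0,T]$ derived from $Z$ coincides with the law of the $\alpha$-Wiener bridge. Indeed, these laws do not even coincide (in the sense of finite-dimensional distributions) on the time interval $[0,T)$. -/

import Mathlib

open MeasureTheory ProbabilityTheory Set Filter Topology
open scoped NNReal ENNReal

noncomputable section

namespace OUBridge

/-- A step function `∑ᵢ cᵢ 𝟙_(tᵢ, tᵢ₊₁]` on `[0, t]`, given by its partition points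
`t₀ ≤ t₁ ≤ … ≤ tₙ` in `[0, t]` and its values `c₀, …, cₙ₋₁`. -/
structure StepFun (t : ℝ≥0) where
  n : ℕ
  pt : Fin (n + 1) → ℝ≥0
  mono : Monotone pt
  le_right : ∀ i, pt i ≤ t
  val : Fin n → ℝ

/-- The step function as a function of time. -/
def StepFun.toFun {t : ℝ≥0} (φ : StepFun t) (s : ℝ) : ℝ :=
  ∑ i : Fin φ.n,
    (Ioc (φ.pt i.castSucc : ℝ) (φ.pt i.succ : ℝ)).indicator (fun _ => φ.val i) s

/-- The elementary integral `∑ᵢ cᵢ (B (tᵢ₊₁) - B (tᵢ))` of a step function. -/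
def StepFun.integral {t : ℝ≥0} {Ω : Type*} (φ : StepFun t) (B : ℝ≥0 → Ω → ℝ) (ω : Ω) : ℝ :=
  ∑ i : Fin φ.n, φ.val i * (B (φ.pt i.succ) ω - B (φ.pt i.castSucc) ω)

/-- `J` is (a version of) the stochastic integral `∫₀ᵗ f(s) dB_s` of the deterministic
function `f ∈ L²([0, t])` with respect to the Wiener process `B`: the `L²(P)`-limit of the
elementary integrals of step functions that converge to `f` in `L²([0, t])`. -/
structure IsWienerIntegral {Ω : Type*} [MeasurableSpace Ω] (B : ℝ≥0 → Ω → ℝ) (P : Measure Ω)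
    (f : ℝ → ℝ) (t : ℝ≥0) (J : Ω → ℝ) : Prop where
  memLp_integrand : MemLp f 2 (volume.restrict (Ioc (0 : ℝ) t))
  memLp : MemLp J 2 P
  exists_approx : ∃ φ : ℕ → StepFun t,
    Tendsto (fun k => eLpNorm (fun s => f s - (φ k).toFun s) 2 (volume.restrict (Ioc (0 : ℝ) t)))
      atTop (𝓝 0) ∧
    Tendsto (fun k => eLpNorm (fun ω => J ω - (φ k).integral B ω) 2 P) atTop (𝓝 0)

/-- Two real processes with the same time set, possibly on different probability spaces, have
the same law, i.e. the same finite-dimensional distributions. -/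
def SameLaw {S Ω Ω' : Type*} [MeasurableSpace Ω] [MeasurableSpace Ω']
    (X : S → Ω → ℝ) (P : Measure Ω) (Y : S → Ω' → ℝ) (P' : Measure Ω') : Prop :=
  ∀ I : Finset S,
    IdentDistrib (fun ω => I.restrict (fun t => X t ω)) (fun ω => I.restrict (fun t => Y t ω)) P P'

/-! ### `α`-Wiener bridges -/

/-- `X` is the process `X_t = ∫₀ᵗ ((T - t) / (T - s)) ^ α dB_s`, `t ∈ [0, T)`. -/
def IsAlphaWienerBridgeDrivenBy {Ω : Type*} [MeasurableSpace Ω] (α T : ℝ)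
    (B : ℝ≥0 → Ω → ℝ) (P : Measure Ω) (X : Ico (0 : ℝ) T → Ω → ℝ) : Prop :=
  ∀ t : Ico (0 : ℝ) T,
    IsWienerIntegral B P (fun s => ((T - t) / (T - s)) ^ α) ⟨(t : ℝ), t.2.1⟩ (X t)

/-- `X` (on `(Ω', P')`) is an `α`-Wiener bridge on `[0, T)`: an almost surely continuous process
with the same finite-dimensional distributions as the process
`t ↦ ∫₀ᵗ ((T - t) / (T - s)) ^ α dB_s`, where `B` is a Wiener process on `(Ω, P)`. -/
structure IsAlphaWienerBridge {Ω Ω' : Type*} [MeasurableSpace Ω] [MeasurableSpace Ω']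
    (α T : ℝ) (B : ℝ≥0 → Ω → ℝ) (P : Measure Ω)
    (X : Ico (0 : ℝ) T → Ω' → ℝ) (P' : Measure Ω') : Prop where
  brownian : IsBrownianReal B P
  continuous_paths : ∀ᵐ ω ∂P', Continuous (fun t => X t ω)
  sameLaw : ∃ X₀ : Ico (0 : ℝ) T → Ω → ℝ,
    IsAlphaWienerBridgeDrivenBy α T B P X₀ ∧ SameLaw X P' X₀ P

/-! ### Ornstein–Uhlenbeck type processes and their bridges -/

/-- `Z` is an Ornstein–Uhlenbeck type process: it has continuous paths and solves
`dZ_t = q(t) Z_t dt + σ(t) dB_t`, `t ≥ 0`, that is,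
`Z_t - Z_0 - ∫₀ᵗ q(s) Z_s ds = ∫₀ᵗ σ(s) dB_s` almost surely for every `t ≥ 0`. Here `q` and `σ`
are continuous on `[0, ∞)`, `σ` has no zero, `B` is a Wiener process and `Z_0` is a (possibly
degenerate) Gauss random variable independent of `B`. -/
structure IsOUProcess {Ω : Type*} [MeasurableSpace Ω] (q σ : ℝ → ℝ)
    (B Z : ℝ≥0 → Ω → ℝ) (P : Measure Ω) : Prop where
  continuousOn_q : ContinuousOn q (Ici 0)
  continuousOn_sigma : ContinuousOn σ (Ici 0)
  sigma_ne_zero : ∀ t, 0 ≤ t → σ t ≠ 0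
  brownian : IsBrownianReal B P
  gaussian_init : HasGaussianLaw (Z 0) P
  indep_init : IndepFun (Z 0) (fun ω t => B t ω) P
  continuous_paths : ∀ᵐ ω ∂P, Continuous (fun t => Z t ω)
  sde : ∀ t : ℝ≥0, IsWienerIntegral B P σ t
    (fun ω => Z t ω - Z 0 ω - ∫ s in (0 : ℝ)..t, q s * Z s.toNNReal ω)

/-- `q̄(t) = ∫₀ᵗ q(u) du`. -/
def qBar (q : ℝ → ℝ) (t : ℝ) : ℝ := ∫ u in (0 : ℝ)..t, q u

/-- `γ(s, t) = ∫ₛᵗ exp (2 (q̄(t) - q̄(u))) σ(u)² du`, the variance of `Z_t` given `Z_s`. -/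
def gam (q σ : ℝ → ℝ) (s t : ℝ) : ℝ :=
  ∫ u in s..t, Real.exp (2 * (qBar q t - qBar q u)) * σ u ^ 2

/-- The mean `n_{a,b}(s, t)` of the bridge ending at `b` at time `T`, given the value `a` at
time `s`. -/
def bridgeMean (q σ : ℝ → ℝ) (T a b s t : ℝ) : ℝ :=
  gam q σ s t / gam q σ s T * Real.exp (qBar q T - qBar q t) * b +
    gam q σ t T / gam q σ s T * Real.exp (qBar q t - qBar q s) * a

/-- `U` is the process
`U_t = n_{a,b}(0, t) + ∫₀ᵗ (γ(t, T) / γ(s, T)) exp (q̄(t) - q̄(s)) σ(s) dB_s`, `t ∈ [0, T)`, with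
`U_T = b`. -/
structure IsOUBridgeDrivenBy {Ω : Type*} [MeasurableSpace Ω] (q σ : ℝ → ℝ) (T a b : ℝ)
    (B : ℝ≥0 → Ω → ℝ) (P : Measure Ω) (U : Icc (0 : ℝ) T → Ω → ℝ) : Prop where
  eq_before : ∀ t : Icc (0 : ℝ) T, (t : ℝ) < T →
    IsWienerIntegral B P
      (fun s => gam q σ t T / gam q σ s T * Real.exp (qBar q t - qBar q s) * σ s)
      ⟨(t : ℝ), t.2.1⟩ (fun ω => U t ω - bridgeMean q σ T a b 0 t)
  eq_end : ∀ t : Icc (0 : ℝ) T, (t : ℝ) = T → U t =ᵐ[P] fun _ => b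

/-- `U` (on `(Ω', P')`) is a bridge from `a` to `b` over `[0, T]` derived from the
Ornstein–Uhlenbeck type process `Z` (on `(Ω, P)`) with coefficients `q`, `σ` and driving Wiener
process `B`. -/
structure IsOUBridge {Ω Ω' : Type*} [MeasurableSpace Ω] [MeasurableSpace Ω']
    (q σ : ℝ → ℝ) (B Z : ℝ≥0 → Ω → ℝ) (P : Measure Ω) (T a b : ℝ)
    (U : Icc (0 : ℝ) T → Ω' → ℝ) (P' : Measure Ω') : Prop where
  process : IsOUProcess q σ B Z P
  continuous_paths : ∀ᵐ ω ∂P', Continuous (fun t => U t ω)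
  sameLaw : ∃ U₀ : Icc (0 : ℝ) T → Ω → ℝ,
    IsOUBridgeDrivenBy q σ T a b B P U₀ ∧ SameLaw U P' U₀ P

/-- Restriction of a process on `[0, T]` to the time interval `[0, T)`. -/
def restrictIco {Ω : Type*} {T : ℝ} (U : Icc (0 : ℝ) T → Ω → ℝ) : Ico (0 : ℝ) T → Ω → ℝ :=
  fun t => U ⟨(t : ℝ), Ico_subset_Icc_self t.2⟩

end OUBridge

end

namespace OUBridge

/-! Equal laws force equal covariances, and these already differ near `T`. Fix `s` in `(0, T)` and
let `t ≥ s` vary. By the Itô isometry (`IsWienerIntegral.integral_mul`), the covariance at `(s, t)`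
factors into a function of `t` times a constant depending only on `s`: for the `α`-Wiener bridge the
function is `(T - t) ^ α`, for the bridge derived from `Z` it is `γ(t, T) exp (q̄(t))`, with a
positive constant. Since `σ` has no zero, compactness bounds the latter above and below by multiples
of `T - t` (`exists_bounds_gam_mul_exp`). So a multiple of `x ^ α` is comparable to `x` as `x`
decreases to `0`, which forces `α = 1` (`eq_one_of_rpow_comparable`). Only times before `T` enter.
-/

/-- The mixed second moments of two processes with the same law agree. -/
lemma SameLaw.integral_mul_eq {S Ω Ω' : Type*} [MeasurableSpace Ω] [MeasurableSpace Ω']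
    {X : S → Ω → ℝ} {P : Measure Ω} {Y : S → Ω' → ℝ} {P' : Measure Ω'}
    (h : SameLaw X P Y P') (s t : S) :
    ∫ ω, X s ω * X t ω ∂P = ∫ ω, Y s ω * Y t ω ∂P' := by
  classical
  let I : Finset S := {s, t}
  have hs : s ∈ I := by simp [I]
  have ht : t ∈ I := by simp [I]
  have hm : Measurable (fun x : I → ℝ => x ⟨s, hs⟩ * x ⟨t, ht⟩) := by fun_prop
  exact ((h I).comp hm).integral_eq

/-- If `fₖ → f` and `gₖ → g` in `L²`, then `∫ fₖ gₖ → ∫ f g`. -/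
lemma tendsto_integral_mul_of_tendsto_eLpNorm_two {A : Type*} [MeasurableSpace A] {μ : Measure A}
    {f g : A → ℝ} {F G : ℕ → A → ℝ} (hf : MemLp f 2 μ) (hg : MemLp g 2 μ)
    (hF : ∀ k, MemLp (F k) 2 μ) (hG : ∀ k, MemLp (G k) 2 μ)
    (hfF : Tendsto (fun k => eLpNorm (fun a => f a - F k a) 2 μ) atTop (𝓝 0))
    (hgG : Tendsto (fun k => eLpNorm (fun a => g a - G k a) 2 μ) atTop (𝓝 0)) :
    Tendsto (fun k => ∫ a, F k a * G k a ∂μ) atTop (𝓝 (∫ a, f a * g a ∂μ)) := by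
  have aux {f : A → ℝ} {F : ℕ → A → ℝ} (hf : MemLp f 2 μ) (hF : ∀ k, MemLp (F k) 2 μ)
      (h : Tendsto (fun k => eLpNorm (fun a => f a - F k a) 2 μ) atTop (𝓝 0)) :
      Tendsto (fun k => (hF k).toLp (F k)) atTop (𝓝 (hf.toLp f)) := by
    rw [Lp.tendsto_Lp_iff_tendsto_eLpNorm'']
    refine h.congr fun k => ?_
    exact eLpNorm_sub_comm f (F k) 2 μ
  have key {f g : A → ℝ} (hf : MemLp f 2 μ) (hg : MemLp g 2 μ) :
      inner ℝ (hf.toLp f) (hg.toLp g) = ∫ a, f a * g a ∂μ := by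
    rw [L2.inner_def]
    refine integral_congr_ae ?_
    filter_upwards [hf.coeFn_toLp, hg.coeFn_toLp] with a h1 h2
    simp [h1, h2, mul_comm]
  have := (aux hf hF hfF).inner (𝕜 := ℝ) (aux hg hG hgG)
  simpa only [key] using this

/-! ### Itô isometry for deterministic integrands. -/

lemma _root_.ProbabilityTheory.IsBrownianReal.memLp_eval {Ω : Type*} [MeasurableSpace Ω]
    {B : ℝ≥0 → Ω → ℝ} {P : Measure Ω} (hB : IsBrownianReal B P) (t : ℝ≥0) : MemLp (B t) 2 P :=
  (hB.toIsPreBrownianReal.isGaussianProcess.hasGaussianLaw_eval t).memLp_two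

lemma _root_.ProbabilityTheory.IsBrownianReal.integral_mul_eval {Ω : Type*} [MeasurableSpace Ω]
    {B : ℝ≥0 → Ω → ℝ} {P : Measure Ω} (hB : IsBrownianReal B P) (s t : ℝ≥0) :
    ∫ ω, B s ω * B t ω ∂P = min (s : ℝ) t := by
  have := (hB.toIsPreBrownianReal.isGaussianProcess).isProbabilityMeasure
  have h := hB.toIsPreBrownianReal.covariance_eval s t
  rw [covariance_eq_sub (hB.memLp_eval s) (hB.memLp_eval t),
    hB.toIsPreBrownianReal.integral_eval s] at h
  simpa using h

/-- The covariance of two increments is the length of the overlap of the time intervals. -/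
lemma _root_.ProbabilityTheory.IsBrownianReal.integral_mul_increments {Ω : Type*}
    [MeasurableSpace Ω] {B : ℝ≥0 → Ω → ℝ} {P : Measure Ω} (hB : IsBrownianReal B P)
    {a b c d : ℝ≥0} (hab : a ≤ b) (hcd : c ≤ d) :
    ∫ ω, (B b ω - B a ω) * (B d ω - B c ω) ∂P =
      volume.real (Ioc (a : ℝ) b ∩ Ioc (c : ℝ) d) := by
  have hi (s t : ℝ≥0) : Integrable (fun ω => B s ω * B t ω) P :=
    (hB.memLp_eval s).integrable_mul (hB.memLp_eval t)
  have h : ∀ ω, (B b ω - B a ω) * (B d ω - B c ω) =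
      (B b ω * B d ω - B a ω * B d ω) - (B b ω * B c ω - B a ω * B c ω) := fun ω => by ring
  simp_rw [h]
  have hsub (s t u v : ℝ≥0) : Integrable (fun ω => B s ω * B t ω - B u ω * B v ω) P :=
    (hi s t).sub (hi u v)
  rw [integral_sub (hsub _ _ _ _) (hsub _ _ _ _),
    integral_sub (hi _ _) (hi _ _), integral_sub (hi _ _) (hi _ _)]
  simp only [hB.integral_mul_eval]
  rw [Ioc_inter_Ioc, Real.volume_real_Ioc]
  have hab' : (a : ℝ) ≤ b := hab
  have hcd' : (c : ℝ) ≤ d := hcd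
  simp only [min_def, max_def]
  grind

lemma StepFun.memLp_toFun {t : ℝ≥0} (φ : StepFun t) (s : ℝ≥0) :
    MemLp φ.toFun 2 (volume.restrict (Ioc (0 : ℝ) s)) := by
  unfold StepFun.toFun
  refine memLp_finsetSum _ fun i _ => ?_
  exact (memLp_const _).indicator measurableSet_Ioc

lemma StepFun.memLp_integral {Ω : Type*} [MeasurableSpace Ω] {B : ℝ≥0 → Ω → ℝ} {P : Measure Ω}
    (hB : IsBrownianReal B P) {t : ℝ≥0} (φ : StepFun t) : MemLp (φ.integral B) 2 P := by
  unfold StepFun.integral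
  refine memLp_finsetSum _ fun i _ => ?_
  exact ((hB.memLp_eval _).sub (hB.memLp_eval _)).const_mul _

/-- The Itô isometry for step functions. -/
lemma StepFun.integral_mul_integral {Ω : Type*} [MeasurableSpace Ω] {B : ℝ≥0 → Ω → ℝ}
    {P : Measure Ω} (hB : IsBrownianReal B P) {s t : ℝ≥0} (φ : StepFun s) (ψ : StepFun t) :
    ∫ ω, φ.integral B ω * ψ.integral B ω ∂P =
      ∫ u in Ioc (0 : ℝ) s, φ.toFun u * ψ.toFun u := by
  have hinc (c d : ℝ) (a b a' b' : ℝ≥0) :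
      Integrable (fun ω => c * (B b ω - B a ω) * (d * (B b' ω - B a' ω))) P :=
    (((hB.memLp_eval b).sub (hB.memLp_eval a)).const_mul c).integrable_mul
      (((hB.memLp_eval b').sub (hB.memLp_eval a')).const_mul d)
  have hind (c d a b a' b' : ℝ) : Integrable
      (fun u => (Ioc a b).indicator (fun _ => c) u * (Ioc a' b').indicator (fun _ => d) u)
      (volume.restrict (Ioc (0 : ℝ) s)) :=
    MemLp.integrable_mul (p := 2) (q := 2) ((memLp_const c).indicator measurableSet_Ioc)
      ((memLp_const d).indicator measurableSet_Ioc)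
  simp only [StepFun.integral, StepFun.toFun, Finset.sum_mul_sum]
  rw [integral_finsetSum _ fun i _ => integrable_finsetSum _ fun j _ => hinc _ _ _ _ _ _,
    integral_finsetSum _ fun i _ => integrable_finsetSum _ fun j _ => hind _ _ _ _ _ _]
  refine Finset.sum_congr rfl fun i _ => ?_
  rw [integral_finsetSum _ fun j _ => hinc _ _ _ _ _ _,
    integral_finsetSum _ fun j _ => hind _ _ _ _ _ _]
  refine Finset.sum_congr rfl fun j _ => ?_
  have h : ∀ ω, φ.val i * (B (φ.pt i.succ) ω - B (φ.pt i.castSucc) ω) *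
      (ψ.val j * (B (ψ.pt j.succ) ω - B (ψ.pt j.castSucc) ω)) = φ.val i * ψ.val j *
      ((B (φ.pt i.succ) ω - B (φ.pt i.castSucc) ω) *
        (B (ψ.pt j.succ) ω - B (ψ.pt j.castSucc) ω)) := fun ω => by ring
  simp_rw [h]
  rw [integral_const_mul, hB.integral_mul_increments (φ.mono (Fin.castSucc_le_succ i))
    (ψ.mono (Fin.castSucc_le_succ j))]
  have h' : ∀ u, (Ioc (φ.pt i.castSucc : ℝ) (φ.pt i.succ)).indicator (fun _ => φ.val i) u *
      (Ioc (ψ.pt j.castSucc : ℝ) (ψ.pt j.succ)).indicator (fun _ => ψ.val j) u =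
      (Ioc (φ.pt i.castSucc : ℝ) (φ.pt i.succ) ∩ Ioc (ψ.pt j.castSucc : ℝ) (ψ.pt j.succ)).indicator
        (fun _ => φ.val i * ψ.val j) u := fun u => (inter_indicator_mul _ _ u).symm
  -- Only the intervals of `φ` need to lie in `(0, s]`: they already confine the intersection.
  have hsub : Ioc (φ.pt i.castSucc : ℝ) (φ.pt i.succ) ⊆ Ioc 0 s :=
    Ioc_subset_Ioc (NNReal.coe_nonneg _) (NNReal.coe_le_coe.2 (φ.le_right i.succ))
  simp_rw [h']
  rw [integral_indicator (measurableSet_Ioc.inter measurableSet_Ioc), setIntegral_const,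
    smul_eq_mul, mul_comm, measureReal_restrict_apply (measurableSet_Ioc.inter measurableSet_Ioc),
    inter_eq_left.mpr (inter_subset_left.trans hsub)]

/-- The Itô isometry for deterministic integrands. -/
lemma IsWienerIntegral.integral_mul {Ω : Type*} [MeasurableSpace Ω] {B : ℝ≥0 → Ω → ℝ}
    {P : Measure Ω} (hB : IsBrownianReal B P) {f g : ℝ → ℝ} {s t : ℝ≥0} {J K : Ω → ℝ}
    (hJ : IsWienerIntegral B P f s J) (hK : IsWienerIntegral B P g t K) (hst : s ≤ t) :
    ∫ ω, J ω * K ω ∂P = ∫ u in Ioc (0 : ℝ) s, f u * g u := by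
  obtain ⟨φ, hφ, hφJ⟩ := hJ.exists_approx
  obtain ⟨ψ, hψ, hψK⟩ := hK.exists_approx
  -- The step functions `ψ k` approximate `g` on `(0, t]`, hence also on the smaller interval `(0,
  -- s]`.
  have hle : volume.restrict (Ioc (0 : ℝ) s) ≤ volume.restrict (Ioc (0 : ℝ) t) :=
    Measure.restrict_mono (Ioc_subset_Ioc_right (NNReal.coe_le_coe.2 hst)) le_rfl
  have h1 := tendsto_integral_mul_of_tendsto_eLpNorm_two hJ.memLp hK.memLp
    (fun k => (φ k).memLp_integral hB) (fun k => (ψ k).memLp_integral hB) hφJ hψK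
  have h2 := tendsto_integral_mul_of_tendsto_eLpNorm_two hJ.memLp_integrand
    (hK.memLp_integrand.mono_measure hle) (fun k => (φ k).memLp_toFun s)
    (fun k => (ψ k).memLp_toFun s) hφ
    (tendsto_of_tendsto_of_tendsto_of_le_of_le tendsto_const_nhds hψ (fun _ => zero_le)
      fun k => eLpNorm_mono_measure _ hle)
  simp only [StepFun.integral_mul_integral hB] at h1
  exact tendsto_nhds_unique h1 h2

/-! ### Covariances of the two bridges. -/

/-- The covariance of the `α`-Wiener bridge as a function of the later time. -/
lemma IsAlphaWienerBridgeDrivenBy.exists_integral_mul_eq {Ω : Type*} [MeasurableSpace Ω]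
    {α T : ℝ} {B : ℝ≥0 → Ω → ℝ} {P : Measure Ω} (hB : IsBrownianReal B P)
    {X : Ico (0 : ℝ) T → Ω → ℝ} (hX : IsAlphaWienerBridgeDrivenBy α T B P X)
    (s : Ico (0 : ℝ) T) :
    ∃ c, ∀ t : Ico (0 : ℝ) T, s ≤ t → ∫ ω, X s ω * X t ω ∂P = (T - t) ^ α * c := by
  refine ⟨∫ u in Ioc (0 : ℝ) s, ((T - s) / (T - u)) ^ α / (T - u) ^ α, fun t hst => ?_⟩
  rw [(hX s).integral_mul hB (hX t) hst, ← integral_const_mul]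
  refine setIntegral_congr_fun measurableSet_Ioc fun u hu => ?_
  have hu' : 0 ≤ T - u := sub_nonneg.2 (hu.2.trans s.2.2.le)
  simp only [Real.div_rpow (sub_nonneg.2 t.2.2.le) hu']
  ring

section OU

variable {q σ : ℝ → ℝ} {T : ℝ}

lemma continuousOn_qBar (hT : 0 ≤ T) (hq : ContinuousOn q (Ici 0)) :
    ContinuousOn (qBar q) (Icc 0 T) := by
  have h : IntegrableOn q (uIcc 0 T) := by
    rw [uIcc_of_le hT]
    exact (hq.mono Icc_subset_Ici_self).integrableOn_Icc
  have h' := intervalIntegral.continuousOn_primitive_interval h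
  rwa [uIcc_of_le hT] at h'

/-- `γ(t, T)` is comparable to `T - t`. -/
lemma exists_bounds_gam_mul_exp (hT : 0 < T) (hq : ContinuousOn q (Ici 0))
    (hσ : ContinuousOn σ (Ici 0)) (hσ0 : ∀ t, 0 ≤ t → σ t ≠ 0) :
    ∃ m M : ℝ, 0 < m ∧ ∀ t ∈ Icc 0 T,
      m * (T - t) ≤ gam q σ t T * Real.exp (qBar q t) ∧
      gam q σ t T * Real.exp (qBar q t) ≤ M * (T - t) := by
  have hqc := continuousOn_qBar hT.le hq
  have hσc : ContinuousOn σ (Icc 0 T) := hσ.mono Icc_subset_Ici_self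
  have hne : (Icc 0 T).Nonempty := nonempty_Icc.2 hT.le
  have hec : ContinuousOn (fun t => Real.exp (qBar q t)) (Icc 0 T) := hqc.rexp
  have hhc : ContinuousOn (fun u => Real.exp (2 * (qBar q T - qBar q u)) * σ u ^ 2)
      (Icc 0 T) := by fun_prop
  -- The constants `m` and `M` are products of the extrema on `[0, T]` of `exp (q̄)` and of the
  -- integrand of `γ(·, T)`.
  obtain ⟨x₁, hx₁, h₁⟩ := isCompact_Icc.exists_isMinOn hne hec
  obtain ⟨x₂, hx₂, h₂⟩ := isCompact_Icc.exists_isMaxOn hne hec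
  obtain ⟨y₁, hy₁, k₁⟩ := isCompact_Icc.exists_isMinOn hne hhc
  obtain ⟨y₂, hy₂, k₂⟩ := isCompact_Icc.exists_isMaxOn hne hhc
  have hpos : ∀ u ∈ Icc 0 T, 0 < Real.exp (2 * (qBar q T - qBar q u)) * σ u ^ 2 := fun u hu =>
    mul_pos (Real.exp_pos _) (pow_pos (abs_pos.2 (hσ0 u hu.1)) 2 |>.trans_eq (sq_abs _))
  refine ⟨(Real.exp (2 * (qBar q T - qBar q y₁)) * σ y₁ ^ 2) * Real.exp (qBar q x₁),
    (Real.exp (2 * (qBar q T - qBar q y₂)) * σ y₂ ^ 2) * Real.exp (qBar q x₂),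
    mul_pos (hpos _ hy₁) (Real.exp_pos _), fun t ht => ?_⟩
  have hint : IntervalIntegrable (fun u => Real.exp (2 * (qBar q T - qBar q u)) * σ u ^ 2)
      volume t T :=
    (hhc.mono (by rw [uIcc_of_le ht.2]; exact Icc_subset_Icc_left ht.1)).intervalIntegrable
  have hlow : (Real.exp (2 * (qBar q T - qBar q y₁)) * σ y₁ ^ 2) * (T - t) ≤ gam q σ t T := by
    have := intervalIntegral.integral_mono_on ht.2 intervalIntegrable_const hint
      fun u hu => k₁ (⟨ht.1.trans hu.1, hu.2⟩ : u ∈ Icc 0 T)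
    rw [intervalIntegral.integral_const, smul_eq_mul, mul_comm] at this
    exact this
  have hup : gam q σ t T ≤ (Real.exp (2 * (qBar q T - qBar q y₂)) * σ y₂ ^ 2) * (T - t) := by
    have := intervalIntegral.integral_mono_on ht.2 hint intervalIntegrable_const
      fun u hu => k₂ (⟨ht.1.trans hu.1, hu.2⟩ : u ∈ Icc 0 T)
    rw [intervalIntegral.integral_const, smul_eq_mul, mul_comm (T - t)] at this
    exact this
  have hTt : 0 ≤ T - t := sub_nonneg.2 ht.2
  have hγ : 0 ≤ gam q σ t T := (mul_nonneg (hpos _ hy₁).le hTt).trans hlow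
  constructor
  · rw [mul_right_comm]
    exact mul_le_mul hlow (h₁ ht) (Real.exp_pos _).le hγ
  · rw [mul_right_comm]
    exact mul_le_mul hup (h₂ ht) (Real.exp_pos _).le (hγ.trans hup)

/-- The covariance of the bridge from `0` to `0` as a function of the later time. -/
lemma IsOUBridgeDrivenBy.exists_integral_mul_eq {Ω : Type*} [MeasurableSpace Ω]
    {B : ℝ≥0 → Ω → ℝ} {P : Measure Ω} (hB : IsBrownianReal B P)
    {U : Icc (0 : ℝ) T → Ω → ℝ} (hU : IsOUBridgeDrivenBy q σ T 0 0 B P U)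
    (hσ0 : ∀ t, 0 ≤ t → σ t ≠ 0) (hγ : ∀ t ∈ Ico 0 T, 0 < gam q σ t T)
    (s : Ico (0 : ℝ) T) (hs : 0 < (s : ℝ)) :
    ∃ c, 0 < c ∧ ∀ t : Ico (0 : ℝ) T, s ≤ t →
      ∫ ω, restrictIco U s ω * restrictIco U t ω ∂P =
        gam q σ t T * Real.exp (qBar q t) * c := by
  have hW (t : Ico (0 : ℝ) T) : IsWienerIntegral B P
      (fun u => gam q σ t T / gam q σ u T * Real.exp (qBar q t - qBar q u) * σ u)
      ⟨(t : ℝ), t.2.1⟩ (restrictIco U t) := by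
    simpa [bridgeMean, restrictIco] using
      hU.eq_before ⟨(t : ℝ), Ico_subset_Icc_self t.2⟩ t.2.2
  -- What remains of the product of the two integrands once the factor depending on `t` is pulled
  -- out.
  set k : ℝ → ℝ := fun u => gam q σ s T * Real.exp (qBar q s) *
    (σ u * Real.exp (-qBar q u) / gam q σ u T) ^ 2 with hk
  have hprod (t : Ico (0 : ℝ) T) (u : ℝ) :
      (gam q σ s T / gam q σ u T * Real.exp (qBar q s - qBar q u) * σ u) *
      (gam q σ t T / gam q σ u T * Real.exp (qBar q t - qBar q u) * σ u) =
      gam q σ t T * Real.exp (qBar q t) * k u := by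
    simp only [hk, sub_eq_add_neg, Real.exp_add]
    ring
  have hA : 0 < gam q σ s T * Real.exp (qBar q s) := mul_pos (hγ s s.2) (Real.exp_pos _)
  have hkint : IntervalIntegrable k volume 0 s := by
    rw [intervalIntegrable_iff_integrableOn_Ioc_of_le hs.le]
    -- At `t = s` the product is the square of an `L²` integrand, so `k` is integrable after
    -- division by a positive constant.
    have h := ((hW s).memLp_integrand.integrable_sq).const_mul
      (gam q σ s T * Real.exp (qBar q s))⁻¹
    refine h.congr (ae_of_all _ fun u => ?_)
    simp only [sq (gam q σ s T / gam q σ u T * _ * _)]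
    rw [hprod s u, inv_mul_cancel_left₀ hA.ne']
  refine ⟨∫ u in (0 : ℝ)..s, k u,
    intervalIntegral.intervalIntegral_pos_of_pos_on hkint (fun u hu => ?_) hs, fun t hst => ?_⟩
  · have hγu := hγ u ⟨hu.1.le, hu.2.trans s.2.2⟩
    have hσu := hσ0 u hu.1.le
    refine mul_pos hA (sq_pos_of_ne_zero ?_)
    positivity
  · rw [(hW s).integral_mul hB (hW t) hst, intervalIntegral.integral_of_le hs.le,
      ← integral_const_mul]
    exact setIntegral_congr_fun measurableSet_Ioc fun u _ => hprod t u

end OU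

/-! ### Comparison near the endpoint. -/

/-- A multiple of `x ^ α` is comparable to `x` near `0` only if `α = 1`. -/
lemma eq_one_of_rpow_comparable {α K m M r : ℝ} (hr : 0 < r) (hm : 0 < m)
    (h : ∀ x ∈ Ioc 0 r, m * x ≤ x ^ α * K ∧ x ^ α * K ≤ M * x) : α = 1 := by
  have hev : ∀ᶠ x in 𝓝[>] (0 : ℝ), x ∈ Ioc 0 r := Ioc_mem_nhdsGT hr
  have hlim {β : ℝ} (hβ : 0 < β) (C : ℝ) :
      Tendsto (fun x : ℝ => x ^ β * C) (𝓝[>] 0) (𝓝 0) := by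
    have := ((Real.continuousAt_rpow_const 0 β (Or.inr hβ.le)).tendsto.mono_left
      (nhdsWithin_le_nhds (s := Ioi 0))).mul_const C
    rwa [Real.zero_rpow hβ.ne', zero_mul] at this
  by_contra hα
  rcases lt_or_gt_of_ne hα with hlt | hgt
  -- For `α < 1`, the lower bound at `r` gives `K > 0`, while the upper bound gives `K ≤ M x ^ (1 -
  -- α)`, which tends to `0`.
  · have hK : 0 < K := pos_of_mul_pos_right
      ((mul_pos hm hr).trans_le (h r ⟨hr, le_rfl⟩).1) (Real.rpow_nonneg hr.le α)
    refine hK.not_ge (ge_of_tendsto (hlim (sub_pos.2 hlt) M) ?_)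
    filter_upwards [hev] with x hx
    have hp := Real.rpow_pos_of_pos hx.1 α
    rw [Real.rpow_sub hx.1, Real.rpow_one, div_mul_eq_mul_div, le_div_iff₀ hp]
    linarith [(h x hx).2]
  -- For `α > 1`, the lower bound gives `m ≤ K x ^ (α - 1)`, which tends to `0`.
  · refine hm.not_ge (ge_of_tendsto (hlim (sub_pos.2 hgt) K) ?_)
    filter_upwards [hev] with x hx
    rw [Real.rpow_sub hx.1, Real.rpow_one, div_mul_eq_mul_div, le_div_iff₀ hx.1]
    exact (h x hx).1

lemma SameLaw.restrictIco {T : ℝ} {Ω Ω' : Type*} [MeasurableSpace Ω] [MeasurableSpace Ω']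
    {U : Icc (0 : ℝ) T → Ω → ℝ} {P : Measure Ω} {V : Icc (0 : ℝ) T → Ω' → ℝ} {P' : Measure Ω'}
    (h : SameLaw U P V P') (s t : Ico (0 : ℝ) T) :
    ∫ ω, OUBridge.restrictIco U s ω * OUBridge.restrictIco U t ω ∂P =
      ∫ ω, OUBridge.restrictIco V s ω * OUBridge.restrictIco V t ω ∂P' :=
  h.integral_mul_eq ⟨s, Ico_subset_Icc_self s.2⟩ ⟨t, Ico_subset_Icc_self t.2⟩

end OUBridge

theorem mainTheorem5
    (T : ℝ) (hT : 0 < T) (α : ℝ) (hα : α ≠ 1)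
    {Ω₁ Ω₂ Ω₃ Ω₄ : Type*} [MeasurableSpace Ω₁] [MeasurableSpace Ω₂] [MeasurableSpace Ω₃]
    [MeasurableSpace Ω₄]
    (P₁ : Measure Ω₁) (P₂ : Measure Ω₂) (P₃ : Measure Ω₃) (P₄ : Measure Ω₄)
    (B : ℝ≥0 → Ω₁ → ℝ) (X : Ico (0 : ℝ) T → Ω₂ → ℝ)
    (hX : OUBridge.IsAlphaWienerBridge α T B P₁ X P₂) :
    ¬ ∃ (q σ : ℝ → ℝ) (W Z : ℝ≥0 → Ω₃ → ℝ) (U : Icc (0 : ℝ) T → Ω₄ → ℝ),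
      OUBridge.IsOUProcess q σ W Z P₃ ∧
      OUBridge.IsOUBridge q σ W Z P₃ T 0 0 U P₄ ∧
      OUBridge.SameLaw (OUBridge.restrictIco U) P₄ X P₂ := by
  rintro ⟨q, σ, W, Z, U, hZ, hU, hlaw⟩
  obtain ⟨X₀, hX₀, hXX₀⟩ := hX.sameLaw
  obtain ⟨U₀, hU₀, hUU₀⟩ := hU.sameLaw
  obtain ⟨m, M, hm, hbd⟩ := OUBridge.exists_bounds_gam_mul_exp hT hZ.continuousOn_q
    hZ.continuousOn_sigma hZ.sigma_ne_zero
  have hγ : ∀ t ∈ Ico 0 T, 0 < OUBridge.gam q σ t T := fun t ht =>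
    pos_of_mul_pos_left ((mul_pos hm (sub_pos.2 ht.2)).trans_le
      (hbd t (Ico_subset_Icc_self ht)).1) (Real.exp_pos _).le
  -- Any interior time would do; with `T / 2`, the times `t = T - x` satisfy `s ≤ t` for all `x` in
  -- `(0, T / 2]`.
  let s : Ico (0 : ℝ) T := ⟨T / 2, by positivity, by linarith⟩
  obtain ⟨c, hc⟩ := hX₀.exists_integral_mul_eq hX.brownian s
  obtain ⟨d, hd, hcov⟩ := hU₀.exists_integral_mul_eq hZ.brownian hZ.sigma_ne_zero hγ s
    (half_pos hT)
  refine hα (OUBridge.eq_one_of_rpow_comparable (K := c) (M := M * d) (half_pos hT)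
    (mul_pos hm hd) fun x hx => ?_)
  let t : Ico (0 : ℝ) T := ⟨T - x, by linarith [hx.2], by linarith [hx.1]⟩
  have hst : s ≤ t := Subtype.mk_le_mk.2 (by linarith [hx.2])
  have heq : x ^ α * c = OUBridge.gam q σ t T * Real.exp (OUBridge.qBar q t) * d := by
    rw [← hcov t hst, ← hUU₀.restrictIco, hlaw.integral_mul_eq, hXX₀.integral_mul_eq, hc t hst]
    simp [t]
  obtain ⟨h1, h2⟩ := hbd t (Ico_subset_Icc_self t.2)
  have hx' : T - (t : ℝ) = x := by simp [t]
  rw [hx'] at h1 h2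
  rw [heq, mul_right_comm m, mul_right_comm M]
  exact ⟨mul_le_mul_of_nonneg_right h1 hd.le, mul_le_mul_of_nonneg_right h2 hd.le⟩
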